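/- Let $p\neq l$ be primes, let $E$ be a finite extension of $\mathbb{Q}_p$ and let $F/E$ be a totally ramified Galois extension of degree $l$, with $\sigma$ a generator of $\mathrm{Gal}(F/E)$. Let $k$ be the common residue field of $E$ and $F$, and let $n\ge 1$. Let $\alpha$ be an irreducible cuspidal representation of $\mathrm{GL}_n(k)$ on a finite-dimensional $\overline{\mathbb{Q}}_l$-vector space $V$, and let $\omega:F^\times\to\overline{\mathbb{Z}}_l^\times$ be a character whose restriction to $\mathcal{O}_F^\times$ is the inflation of the central character of $\alpha$. Assume that the level zero, minimal-maximal type representation $$\rho=\operatorname{c-Ind}_{F^\times \mathrm{GL}_n(\mathcal{O}_F)}^{\mathrm{GL}_n(F)}\omega\alpha$$ is $\mathrm{Gal}(F/E)$-equivariant, that is, $\rho\cong\rho\circ\gamma$ for all $\gamma\in\mathrm{Gal}(F/E)$ (for example, $\rho$ may be the base change $\mathrm{bc}(\pi)$ of an irreducible cuspidal $l$-adic representation $\pi$ of $\mathrm{GL}_n(E)$ of level zero and minimal-maximal type, when $n$ is prime to $pl$). Let $L\subset V$ be a $\mathrm{GL}_n(k)$-stable $\overline{\mathbb{Z}}_l$-lattice.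 The discrete set $X=F^\times\mathrm{GL}_n(\mathcal{O}_F)\backslash\mathrm{GL}_n(F)$ is the vertex set of the Bruhat-Tits building of $\mathrm{GL}_n(F)$, and $\sigma$ acts on it through the entries of matrices. Let $\mathcal{F}$ be the sheaf on $X$ whose compactly supported sections over $U\subset X$ are the functions $f:\mathrm{GL}_n(F)\to L$ supported on finitely many cosets, all of them in $U$, such that $f(zkg)=\omega(z)\alpha(\bar k)f(g)$ for all $z\in F^\times$, $k\in\mathrm{GL}_n(\mathcal{O}_F)$ with reduction $\bar k\in \mathrm{GL}_n(k)$, and $g\in\mathrm{GL}_n(F)$. Let $\lambda:\mathcal{F}(U)\to\mathcal{F}(\sigma^{-1}U)$ be given by $(\lambda f)(g)=f(\sigma(g))$, let $N=1+\lambda+\dots+\lambda^{l-1}$, and let $T^0(\mathcal{F})=\ker(1-\lambda)/\operatorname{Im}N$ be the Tate cohomology sheaf on the fixed-point set $X^\sigma$. Then $T^0(\mathcal{F})$ is supported on the vertex set of the building of $\mathrm{GL}_n(E)$, i.e. on the image of the canonical map $E^\times\mathrm{GL}_n(\mathcal{O}_E)\backslash\mathrm{GL}_n(E)\to X$: the stalk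 of $T^0(\mathcal{F})$ at every vertex $w\in X^\sigma$ that is not in this image is $0$. -/

import Mathlib

open Matrix

universe u

noncomputable section

namespace TateBuilding

/-! ### Local fields and their rings of integers -/

/-- The ring of integers of an algebraic extension `K` of `ℚ_[p]`: the closed unit ball of the
unique extension to `K` of the `p`-adic absolute value. For `K` a finite extension this is the ring
of integers of the local field `K`; for `K = PadicAlgCl p` it is the integral closure of the
`p`-adic integers. -/
def integers (p : ℕ) [Fact p.Prime] (K : Type*) [Field K] [Algebra ℚ_[p] K]
    [Algebra.IsAlgebraic ℚ_[p] K] : ValuationSubring K where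
  carrier := {x | spectralNorm ℚ_[p] K x ≤ 1}
  mul_mem' {a b} ha hb := by
    have h := map_mul (spectralMulAlgNorm ℚ_[p] K) a b
    simp only [spectralMulAlgNorm_def] at h
    simp only [Set.mem_ofPred_eq] at ha hb ⊢
    rw [h]
    exact mul_le_one₀ ha (spectralNorm_nonneg b) hb
  one_mem' := by simp [spectralNorm_one]
  add_mem' {a b} ha hb :=
    (isNonarchimedean_spectralNorm (K := ℚ_[p]) (L := K) a b).trans (max_le ha hb)
  zero_mem' := by simp [spectralNorm_zero]
  neg_mem' {a} ha := by
    simp only [Set.mem_ofPred_eq] at ha ⊢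
    rwa [spectralNorm_neg (Algebra.IsAlgebraic.isAlgebraic a)]
  mem_or_inv_mem' a := by
    simp only [Set.mem_ofPred_eq]
    have h := map_inv₀ (spectralMulAlgNorm ℚ_[p] K) a
    simp only [spectralMulAlgNorm_def] at h
    rw [h]
    rcases le_total (spectralNorm ℚ_[p] K a) 1 with h1 | h1
    · exact Or.inl h1
    · exact Or.inr (inv_le_one_of_one_le₀ h1)

lemma mem_integers {p : ℕ} [Fact p.Prime] {K : Type*} [Field K] [Algebra ℚ_[p] K]
    [Algebra.IsAlgebraic ℚ_[p] K] {x : K} :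
    x ∈ integers p K ↔ spectralNorm ℚ_[p] K x ≤ 1 := Iff.rfl

/-- The residue field of `K`. -/
abbrev Residue (p : ℕ) [Fact p.Prime] (K : Type*) [Field K] [Algebra ℚ_[p] K]
    [Algebra.IsAlgebraic ℚ_[p] K] : Type _ := IsLocalRing.ResidueField (integers p K)

/-- A homomorphism of algebraic extensions of `ℚ_[p]` restricts to the rings of integers. -/
def integersMap (p : ℕ) [Fact p.Prime] {K L : Type*} [Field K] [Algebra ℚ_[p] K]
    [Algebra.IsAlgebraic ℚ_[p] K] [Field L] [Algebra ℚ_[p] L] [Algebra.IsAlgebraic ℚ_[p] L]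
    (φ : K →ₐ[ℚ_[p]] L) : integers p K →+* integers p L :=
  (φ : K →+* L).restrict (integers p K) (integers p L) fun x hx => by
    rw [mem_integers] at hx ⊢
    have h : minpoly ℚ_[p] (φ x) = minpoly ℚ_[p] x := minpoly.algHom_eq φ φ.injective x
    simpa [spectralNorm, h] using hx

/-- `F / E` is totally ramified: the residue field of `E` is the whole residue field of `F`. -/
def IsTotallyRamified (p : ℕ) [Fact p.Prime] (E F : Type*) [Field E] [Algebra ℚ_[p] E]
    [Algebra.IsAlgebraic ℚ_[p] E] [Field F] [Algebra ℚ_[p] F] [Algebra.IsAlgebraic ℚ_[p] F]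
    [Algebra E F] [IsScalarTower ℚ_[p] E F] : Prop :=
  Function.Surjective ((IsLocalRing.residue (integers p F)).comp
    (integersMap p (IsScalarTower.toAlgHom ℚ_[p] E F)))

/-! ### Vertices of the building of `GL_n` -/

section Vertices

variable (p : ℕ) [Fact p.Prime] (n : ℕ)
variable (K : Type*) [Field K] [Algebra ℚ_[p] K] [Algebra.IsAlgebraic ℚ_[p] K]

/-- The inclusion of `GL_n` of the ring of integers of `K` into `GL_n(K)`. -/
def integralGL : GL (Fin n) (integers p K) →* GL (Fin n) K :=
  GeneralLinearGroup.map (integers p K).subtype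

/-- Reduction from `GL_n` of the ring of integers of `K` to `GL_n` of the residue field. -/
def reduceGL : GL (Fin n) (integers p K) →* GL (Fin n) (Residue p K) :=
  GeneralLinearGroup.map (IsLocalRing.residue (integers p K))

/-- The subgroup `Kˣ · GL_n(𝒪_K)` of `GL_n(K)`. -/
def maxCompactModCenter : Subgroup (GL (Fin n) K) :=
  (GeneralLinearGroup.scalar (Fin n) : Kˣ →* GL (Fin n) K).range ⊔ (integralGL p n K).range

/-- The vertex set of the Bruhat-Tits building of `GL_n(K)`: the space of right cosets
`(Kˣ GL_n(𝒪_K)) \ GL_n(K)`. The coset of `g` is the homothety class of the `𝒪_K`-lattice spanned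
by the rows of `g`. -/
def Vertex : Type _ := Quotient (QuotientGroup.rightRel (maxCompactModCenter p n K))

variable {K}

/-- The vertex given by the coset of `g`. -/
def vertexMk (g : GL (Fin n) K) : Vertex p n K := Quotient.mk _ g

variable {L : Type*} [Field L] [Algebra ℚ_[p] L] [Algebra.IsAlgebraic ℚ_[p] L]

lemma map_maxCompactModCenter_le (φ : K →ₐ[ℚ_[p]] L) :
    (maxCompactModCenter p n K).map (GeneralLinearGroup.map (φ : K →+* L)) ≤
      maxCompactModCenter p n L := by
  rw [maxCompactModCenter, Subgroup.map_sup]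
  refine sup_le_sup ?_ ?_
  · rintro _ ⟨_, ⟨z, rfl⟩, rfl⟩
    refine ⟨Units.map (φ : K →* L) z, ?_⟩
    ext i j
    by_cases h : i = j <;> simp [h, GeneralLinearGroup.map, GeneralLinearGroup.scalar]
  · rintro _ ⟨_, ⟨k, rfl⟩, rfl⟩
    exact ⟨GeneralLinearGroup.map (integersMap p φ) k, by ext i j; rfl⟩

/-- The map on vertices induced by a field homomorphism, applied to the entries of matrices. -/
def vertexMap (φ : K →ₐ[ℚ_[p]] L) : Vertex p n K → Vertex p n L :=
  Quotient.map' (GeneralLinearGroup.map (φ : K →+* L)) fun a b h => by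
    rw [QuotientGroup.rightRel_apply] at h ⊢
    rw [← map_inv, ← map_mul]
    exact map_maxCompactModCenter_le p n φ (Subgroup.mem_map_of_mem _ h)

end Vertices

/-- The canonical embedding of the vertices of the building of `GL_n(E)` into those of the building
of `GL_n(F)`: its image consists of the homothety classes of lattices having a basis in `E ^ n`. -/
def vertexEmbedding (p : ℕ) [Fact p.Prime] (n : ℕ) (E F : Type*) [Field E] [Algebra ℚ_[p] E]
    [Algebra.IsAlgebraic ℚ_[p] E] [Field F] [Algebra ℚ_[p] F] [Algebra.IsAlgebraic ℚ_[p] F]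
    [Algebra E F] [IsScalarTower ℚ_[p] E F] : Vertex p n E → Vertex p n F :=
  vertexMap p n (IsScalarTower.toAlgHom ℚ_[p] E F)

/-! ### Cuspidal representations of `GL_n` of a (finite) field -/

/-- The maximal standard parabolic subgroup `P_m`: the matrices whose lower-left `(n - m) × m` block
vanishes. -/
def parabolic (k : Type*) [Field k] (n m : ℕ) : Subgroup (GL (Fin n) k) where
  carrier := {g | (g : Matrix (Fin n) (Fin n) k).BlockTriangular fun i => decide (m ≤ (i : ℕ))}
  mul_mem' ha hb := by
    simp only [Set.mem_ofPred_eq, Units.val_mul] at *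
    exact ha.mul hb
  one_mem' := by
    simp only [Set.mem_ofPred_eq, Units.val_one]
    exact blockTriangular_one
  inv_mem' {g} hg := by
    simp only [Set.mem_ofPred_eq, coe_units_inv] at *
    have : Invertible (g : Matrix (Fin n) (Fin n) k) := g.invertible
    exact blockTriangular_inv_of_blockTriangular hg

lemma mem_parabolic {k : Type*} [Field k] {n m : ℕ} {g : GL (Fin n) k} :
    g ∈ parabolic k n m ↔ ∀ i j : Fin n, m ≤ (i : ℕ) → (j : ℕ) < m → g i j = 0 := by
  change Matrix.BlockTriangular _ _ ↔ _
  refine ⟨fun h i j hi hj => h (by simp [hi, Bool.lt_iff, hj]), fun h i j hij => ?_⟩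
  have : m ≤ (i : ℕ) ∧ (j : ℕ) < m := by
    rw [Bool.lt_iff] at hij
    simpa [and_comm] using hij
  exact h i j this.1 this.2

/-- `g` lies in the unipotent radical `U_m` of `P_m`: it coincides with the identity matrix outside
of the upper-right `m × (n - m)` block. -/
def InUnipotentRadical {k : Type*} [Field k] {n : ℕ} (m : ℕ) (g : GL (Fin n) k) : Prop :=
  ∀ i j : Fin n, ¬((i : ℕ) < m ∧ m ≤ (j : ℕ)) → g i j = (1 : Matrix (Fin n) (Fin n) k) i j

/-- `α` is cuspidal: for `1 ≤ m ≤ n - 1` and every representation `τ` of `P_m / U_m` (that is, of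
`P_m` trivial on `U_m`), there is no nonzero homomorphism from `α` to the representation of
`GL_n(k)` induced from `τ`. -/
def IsCuspidal {C k : Type*} [Field C] [Field k] {n : ℕ} {V : Type u} [AddCommGroup V] [Module C V]
    (α : Representation C (GL (Fin n) k) V) : Prop :=
  ∀ m : ℕ, 1 ≤ m → m < n →
    ∀ (W : Type u) [AddCommGroup W] [Module C W] (τ : Representation C (parabolic k n m) W),
      (∀ g : parabolic k n m, InUnipotentRadical m (g : GL (Fin n) k) → τ g = 1) →
        ∀ T : α.IntertwiningMap (Representation.coind (parabolic k n m).subtype τ), T = 0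

/-! ### Level zero representations and the associated sheaf -/

section Sheaf

variable {p : ℕ} [Fact p.Prime] {l : ℕ} [Fact l.Prime] {n : ℕ}
variable {F : Type*} [Field F] [Algebra ℚ_[p] F] [Algebra.IsAlgebraic ℚ_[p] F]
variable {V : Type*} [AddCommGroup V] [Module (PadicAlgCl l) V]

/-- The character `ω` of `Fˣ` extends (the inflation to the units of `𝒪_F` of) the central character
of `α`. -/
def ExtendsCentralCharacter
    (α : Representation (PadicAlgCl l) (GL (Fin n) (Residue p F)) V)
    (ω : Fˣ →* (integers l (PadicAlgCl l))ˣ) : Prop :=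
  ∀ (u : (integers p F)ˣ) (v : V),
    α (reduceGL p n F (GeneralLinearGroup.scalar (Fin n) u)) v =
      ((ω (Units.map (integers p F).subtype.toMonoidHom u) :
        integers l (PadicAlgCl l)) : PadicAlgCl l) • v

/-- The space of the compactly induced representation of `ωα` from `Fˣ GL_n(𝒪_F)` to `GL_n(F)`:
functions `f` with `f (z k g) = ω(z) α(k) f(g)` whose support is a finite union of cosets of
`Fˣ GL_n(𝒪_F)`. -/
def compactInduction (α : Representation (PadicAlgCl l) (GL (Fin n) (Residue p F)) V)
    (ω : Fˣ →* (integers l (PadicAlgCl l))ˣ) : Submodule (PadicAlgCl l) (GL (Fin n) F → V) where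
  carrier := {f |
    (∀ (z : Fˣ) (k : GL (Fin n) (integers p F)) (g : GL (Fin n) F),
      f (GeneralLinearGroup.scalar (Fin n) z * integralGL p n F k * g) =
        ((ω z : integers l (PadicAlgCl l)) : PadicAlgCl l) • α (reduceGL p n F k) (f g)) ∧
    ∃ S : Set (Vertex p n F), S.Finite ∧ ∀ g, vertexMk p n g ∉ S → f g = 0}
  add_mem' := by
    rintro a b ⟨ha, S, hS, haS⟩ ⟨hb, S', hS', hbS⟩
    refine ⟨fun z k g => by simp [ha, hb], S ∪ S', hS.union hS', fun g hg => ?_⟩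
    simp only [Set.mem_union, not_or] at hg
    simp [haS g hg.1, hbS g hg.2]
  zero_mem' := ⟨fun z k g => by simp, ∅, Set.finite_empty, fun g _ => rfl⟩
  smul_mem' := by
    rintro c a ⟨ha, S, hS, haS⟩
    refine ⟨fun z k g => by simp [ha, smul_comm c], S, hS, fun g hg => by simp [haS g hg]⟩

/-- Right translation of a vertex by an element of the group. -/
def vertexTranslate (x : GL (Fin n) F) : Vertex p n F → Vertex p n F :=
  Quotient.map' (· * x) fun a b h => by
    rw [QuotientGroup.rightRel_apply] at h ⊢
    simpa [mul_assoc] using h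

/-- The level zero representation of `GL_n(F)` attached to `α` and `ω`: the compact induction of
`ωα`, with `GL_n(F)` acting by right translation of functions. -/
def levelZeroRep (α : Representation (PadicAlgCl l) (GL (Fin n) (Residue p F)) V)
    (ω : Fˣ →* (integers l (PadicAlgCl l))ˣ) :
    Representation (PadicAlgCl l) (GL (Fin n) F) (compactInduction α ω) where
  toFun x := (LinearMap.funLeft (PadicAlgCl l) V (· * x)).restrict fun f hf => by
    obtain ⟨hf, S, hS, hfS⟩ := hf
    refine ⟨fun z k g => ?_, vertexTranslate x⁻¹ '' S, hS.image _, fun g hg => ?_⟩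
    · simpa [LinearMap.funLeft, mul_assoc] using hf z k (g * x)
    · refine hfS (g * x) fun h => hg ⟨_, h, ?_⟩
      simp only [vertexTranslate, vertexMk, Quotient.map'_mk, mul_inv_cancel_right]
      rfl
  map_one' := by ext; simp [LinearMap.funLeft]
  map_mul' _ _ := by ext; simp [LinearMap.funLeft, mul_assoc]

/-- A representation `ρ` of `GL_n(F)` is `Gal(F/E)`-equivariant: `ρ ≅ ρ ∘ γ` for all `γ` in
`Gal(F/E)`, acting on the entries of matrices. -/
def IsGaloisEquivariant (E : Type*) [Field E] [Algebra E F] {C W : Type*} [Field C]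
    [AddCommGroup W] [Module C W] (ρ : Representation C (GL (Fin n) F) W) : Prop :=
  ∀ γ : F ≃ₐ[E] F,
    Nonempty (ρ.Equiv (ρ.comp (GeneralLinearGroup.map ((γ : F ≃+* F) : F →+* F))))

/-- `L` is a `GL_n`-stable lattice over the integral closure of the `l`-adic integers in the
`l`-adic representation `α`. -/
structure IsStableLattice {G : Type*} [Monoid G] (α : Representation (PadicAlgCl l) G V)
    (L : Submodule (integers l (PadicAlgCl l)) V) : Prop where
  fg : L.FG
  span_eq_top : Submodule.span (PadicAlgCl l) (L : Set V) = ⊤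
  stable : ∀ g, ∀ v ∈ L, α g v ∈ L

/-- The compactly supported sections over `U` of the sheaf on the (discrete) set of vertices of the
building of `GL_n(F)` attached to `ωα` and to the lattice `L` on which `α` acts: the functions
`f : GL_n(F) → L` in the compact induction that are supported on the cosets in `U`. -/
def compactSections (α : Representation (PadicAlgCl l) (GL (Fin n) (Residue p F)) V)
    (ω : Fˣ →* (integers l (PadicAlgCl l))ˣ) (L : Submodule (integers l (PadicAlgCl l)) V)
    (U : Set (Vertex p n F)) :
    Submodule (integers l (PadicAlgCl l)) (GL (Fin n) F → V) where
  carrier := {f | f ∈ compactInduction α ω ∧ (∀ g, f g ∈ L) ∧ ∀ g, vertexMk p n g ∉ U → f g = 0}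
  add_mem' := by
    rintro a b ⟨ha, haL, haU⟩ ⟨hb, hbL, hbU⟩
    exact ⟨add_mem ha hb, fun g => add_mem (haL g) (hbL g),
      fun g hg => by simp [haU g hg, hbU g hg]⟩
  zero_mem' := ⟨zero_mem _, fun g => zero_mem _, fun g _ => rfl⟩
  smul_mem' := by
    rintro c a ⟨ha, haL, haU⟩
    exact ⟨(compactInduction α ω).smul_mem (c : PadicAlgCl l) ha,
      fun g => L.smul_mem c (haL g), fun g hg => by simp [haU g hg]⟩

/-- The operator `(λ f)(g) = f(σ g)`. It maps sections over `U` to sections over `σ⁻¹ U`. -/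
def twist (l : ℕ) [Fact l.Prime] (n : ℕ) {F : Type*} [Field F] (V : Type*) [AddCommGroup V]
    [Module (PadicAlgCl l) V] (σ : F →+* F) :
    (GL (Fin n) F → V) →ₗ[integers l (PadicAlgCl l)] (GL (Fin n) F → V) :=
  LinearMap.funLeft _ V (GeneralLinearGroup.map σ)

/-- The `λ`-invariant sections over `U`. -/
def invariantSections (α : Representation (PadicAlgCl l) (GL (Fin n) (Residue p F)) V)
    (ω : Fˣ →* (integers l (PadicAlgCl l))ˣ) (L : Submodule (integers l (PadicAlgCl l)) V)
    (σ : F →+* F) (U : Set (Vertex p n F)) :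
    Submodule (integers l (PadicAlgCl l)) (GL (Fin n) F → V) :=
  compactSections α ω L U ⊓ LinearMap.ker (1 - twist l n V σ)

/-- The image of the norm `1 + λ + ⋯ + λ^(l-1)` on the sections over `U`. -/
def normSections (α : Representation (PadicAlgCl l) (GL (Fin n) (Residue p F)) V)
    (ω : Fˣ →* (integers l (PadicAlgCl l))ˣ) (L : Submodule (integers l (PadicAlgCl l)) V)
    (σ : F →+* F) (U : Set (Vertex p n F)) :
    Submodule (integers l (PadicAlgCl l)) (GL (Fin n) F → V) :=
  (compactSections α ω L U).map (∑ i ∈ Finset.range l, twist l n V σ ^ i)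

/-- The compactly supported sections of the Tate cohomology sheaf `T⁰ = ker (1 - λ) / im N` over a
set `U` of `σ`-fixed vertices. -/
abbrev TateZero (α : Representation (PadicAlgCl l) (GL (Fin n) (Residue p F)) V)
    (ω : Fˣ →* (integers l (PadicAlgCl l))ˣ) (L : Submodule (integers l (PadicAlgCl l)) V)
    (σ : F →+* F) (U : Set (Vertex p n F)) : Type _ :=
  invariantSections α ω L σ U ⧸ (normSections α ω L σ U).submoduleOf (invariantSections α ω L σ U)

end Sheaf

/-- The set of `σ`-fixed vertices at which the stalk of the Tate cohomology sheaf `T⁰` is nonzero.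
The space of vertices being discrete, this is the support of the sheaf `T⁰`, and its stalk at `w` is
its module of sections over `{w}`. -/
def tateSupport {p : ℕ} [Fact p.Prime] {l : ℕ} [Fact l.Prime] {n : ℕ} {F V : Type*} [Field F]
    [Algebra ℚ_[p] F] [Algebra.IsAlgebraic ℚ_[p] F] [AddCommGroup V] [Module (PadicAlgCl l) V]
    (α : Representation (PadicAlgCl l) (GL (Fin n) (Residue p F)) V)
    (ω : Fˣ →* (integers l (PadicAlgCl l))ˣ) (L : Submodule (integers l (PadicAlgCl l)) V)
    (σ : F →ₐ[ℚ_[p]] F) : Set (Vertex p n F) :=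
  {w | vertexMap p n σ w = w ∧ Nontrivial (TateZero α ω L (σ : F →+* F) {w})}

end TateBuilding

end

/-!
A vertex fixed by `σ` is the coset of some `g` with `σ g = k g`, where `k` lies in `GL_n(𝒪_F)`.
Since `F / E` is totally ramified, `σ` acts trivially on the residue field, so the reduction `s` of
`k` satisfies `s ^ l = 1`; and since the ramification is tame, `σ ϖ = u ϖ` for a uniformizer `ϖ` and
a unit `u` whose residue `ζ` is a primitive `l`-th root of unity.

If `s` is a scalar `ζ ^ i`, then after replacing `g` by `ϖ⁻ⁱ g` we may assume `s = 1`. Then the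
average of the `σ ^ j g` differs from `g` by an element of `GL_n(𝒪_F)`, and it is fixed by `σ`: the
vertex comes from `GL_n(E)`.

If `s` is not a scalar `ζ ^ i`, some polynomial in `s` is an idempotent `P ≠ 0, 1`. A nontrivial
element of the unipotent radical `U` attached to `P` does not commute with `P`, hence not with `s`,
so conjugation by `s` permutes `U \ {1}` with orbits of size `l`. An invariant section at the vertex
is given by a vector `v` fixed by `s`, and `∑_{x ∈ U} x v = 0` by cuspidality. Grouping this sum
into orbits with representatives `r` writes `v` as the norm of `-∑ r v`, so the stalk vanishes.
-/

noncomputable section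

namespace TateBuilding

lemma map_sum_iterate_eq_self {M : Type*} [AddCommGroup M] {φ : M →+ M} {l : ℕ} {x : M}
    (hφ : φ^[l] x = x) :
    φ (∑ i ∈ Finset.range l, φ^[i] x) = ∑ i ∈ Finset.range l, φ^[i] x := by
  have hshift := Finset.sum_range_succ' (φ^[·] x) l
  rw [Finset.sum_range_succ, hφ, Function.iterate_zero_apply] at hshift
  simpa only [map_sum, ← Function.iterate_succ_apply'] using (add_right_cancel hshift).symm

section LocalRing

open IsLocalRing

variable {R : Type*} [CommRing R] [IsLocalRing R]

/-- Every residue class of the local ring `R` has a representative fixed by `τ`. When `R` is the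
ring of integers of `F` and `τ` comes from an automorphism over `E`, this holds as soon as `F / E`
is totally ramified. -/
def HasFixedResidues (τ : R →+* R) : Prop :=
  ∀ x, ∃ a, τ a = a ∧ residue R a = residue R x

namespace HasFixedResidues

variable {τ : R →+* R}

lemma residue_map [IsLocalHom τ] (hτ : HasFixedResidues τ) (x : R) :
    residue R (τ x) = residue R x := by
  obtain ⟨a, ha, hax⟩ := hτ x
  rw [← hax, ← ResidueField.map_residue τ, ← hax, ResidueField.map_residue, ha]

lemma eq_id_of_map_eq_self [IsNoetherianRing R] (hτ : HasFixedResidues τ) {ϖ : R}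
    (hϖ : maximalIdeal R = Ideal.span {ϖ}) (hfix : τ ϖ = ϖ) : τ = RingHom.id R := by
  have hcongr (i : ℕ) : ∀ x, τ x - x ∈ maximalIdeal R ^ i := by
    induction i with
    | zero => simp
    | succ i ih =>
      intro x
      obtain ⟨a, ha, hax⟩ := hτ x
      obtain ⟨y, hy⟩ : ϖ ∣ x - a := by
        rw [← Ideal.mem_span_singleton, ← hϖ, ← residue_eq_zero_iff, map_sub, hax, sub_self]
      have hτx : τ x - x = (τ y - y) * ϖ := by
        rw [sub_eq_iff_eq_add.1 hy, map_add, map_mul, ha, hfix]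
        ring
      rw [hτx, pow_succ]
      exact Ideal.mul_mem_mul (ih y) (hϖ ▸ Ideal.mem_span_singleton_self ϖ)
  ext x
  have hKrull := Ideal.iInf_pow_eq_bot_of_isLocalRing _ (maximalIdeal.isMaximal R).ne_top
  have : τ x - x ∈ ⨅ i, maximalIdeal R ^ i := Ideal.mem_iInf.2 fun i => hcongr i x
  rwa [hKrull, Ideal.mem_bot, sub_eq_zero] at this

lemma exists_iterate_eq_mul [IsLocalHom τ] (hτ : HasFixedResidues τ) {ϖ u : R}
    (hu : τ ϖ = u * ϖ) (i : ℕ) : ∃ v, τ^[i] ϖ = v * ϖ ∧ residue R v = residue R u ^ i := by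
  induction i with
  | zero => exact ⟨1, by simp⟩
  | succ i ih =>
    obtain ⟨v, hv, hres⟩ := ih
    refine ⟨τ v * u, ?_, ?_⟩
    · rw [Function.iterate_succ_apply', hv, map_mul, hu, mul_assoc]
    · rw [map_mul, hτ.residue_map, hres, pow_succ]

end HasFixedResidues

end LocalRing

section DiscreteValuationRing

open IsLocalRing

variable {R : Type*} [CommRing R] [IsDomain R] [IsDiscreteValuationRing R] {τ : R →+* R}
  [IsLocalHom τ] {l : ℕ}

namespace HasFixedResidues

/-- If `τ ϖ ≡ ϖ` modulo `ϖ ^ 2`, then the trace `∑ τ ^ i ϖ ≡ l ϖ` is a fixed uniformizer. -/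
lemma residue_ne_one (hτ : HasFixedResidues τ) (hl : (l : ResidueField R) ≠ 0)
    (hτl : τ^[l] = id) (hτ1 : τ ≠ RingHom.id R) {ϖ u : R} (hϖ : Irreducible ϖ)
    (hu : τ ϖ = u * ϖ) : residue R u ≠ 1 := by
  intro hu1
  choose v hv hres using hτ.exists_iterate_eq_mul hu
  have hunit : IsUnit (∑ i ∈ Finset.range l, v i) := by
    rw [← residue_ne_zero_iff_isUnit, map_sum]
    simpa [hres, hu1] using hl
  have htrace : ∑ i ∈ Finset.range l, τ^[i] ϖ = (∑ i ∈ Finset.range l, v i) * ϖ := by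
    simp only [hv, Finset.sum_mul]
  have hassoc : Associated ϖ (∑ i ∈ Finset.range l, τ^[i] ϖ) := by
    rw [htrace, mul_comm]
    exact (associated_mul_unit_left ϖ _ hunit).symm
  refine hτ1 (hτ.eq_id_of_map_eq_self (hassoc.irreducible hϖ).maximalIdeal_eq ?_)
  exact map_sum_iterate_eq_self (φ := (τ : R →+ R)) (congrFun hτl ϖ)

lemma exists_map_eq_unit_mul [Fact l.Prime] (hτ : HasFixedResidues τ)
    (hl : (l : ResidueField R) ≠ 0) (hτl : τ^[l] = id) (hτ1 : τ ≠ RingHom.id R) :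
    ∃ (ϖ : R) (u : Rˣ), ϖ ≠ 0 ∧ τ ϖ = u * ϖ ∧ IsPrimitiveRoot (residue R u) l := by
  obtain ⟨ϖ, hϖ⟩ := IsDiscreteValuationRing.exists_irreducible R
  obtain ⟨u, hu⟩ : ϖ ∣ τ ϖ := by
    rw [← Ideal.mem_span_singleton, ← hϖ.maximalIdeal_eq, ← residue_eq_zero_iff,
      hτ.residue_map, residue_eq_zero_iff, hϖ.maximalIdeal_eq]
    exact Ideal.mem_span_singleton_self ϖ
  rw [mul_comm] at hu
  have hpow : residue R u ^ l = 1 := by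
    obtain ⟨v, hv, hres⟩ := hτ.exists_iterate_eq_mul hu l
    rw [hτl, id, eq_comm, mul_eq_right₀ hϖ.ne_zero] at hv
    rw [← hres, hv, map_one]
  have hunit : IsUnit u := by
    rw [← residue_ne_zero_iff_isUnit]
    exact (IsUnit.of_pow_eq_one hpow (Fact.out : l.Prime).ne_zero).ne_zero
  exact ⟨ϖ, hunit.unit, hϖ.ne_zero, hu, IsPrimitiveRoot.iff_orderOf.2
    (orderOf_eq_prime hpow (hτ.residue_ne_one hl hτl hτ1 hϖ hu))⟩

end HasFixedResidues

end DiscreteValuationRing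

section LocalField

variable (p : ℕ) [Fact p.Prime]

open scoped Valued in
open Valued.integer in
lemma isDiscreteValuationRing_and_finite_residue (F : Type*) [Field F] [Algebra ℚ_[p] F]
    [FiniteDimensional ℚ_[p] F] :
    IsDiscreteValuationRing (integers p F) ∧ Finite (Residue p F) := by
  let : NontriviallyNormedField F :=
    { spectralNorm.normedField ℚ_[p] F with
      non_trivial := by
        obtain ⟨x, hx⟩ := NormedField.exists_one_lt_norm ℚ_[p]
        exact ⟨algebraMap ℚ_[p] F x, hx.trans_eq (spectralNorm_extends x).symm⟩ }
  let : NormedAlgebra ℚ_[p] F := spectralNorm.normedAlgebra ℚ_[p] F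
  have : ProperSpace F := FiniteDimensional.proper ℚ_[p] F
  have : IsUltrametricDist F := IsUltrametricDist.isUltrametricDist_of_isNonarchimedean_norm
    isNonarchimedean_spectralNorm
  have hcompact : IsCompact (integers p F : Set F) := by
    have hball : (integers p F : Set F) = Metric.closedBall 0 1 :=
      Set.ext fun x => (mem_closedBall_zero_iff (a := x)).symm
    exact hball ▸ isCompact_closedBall 0 1
  let : Valued F NNReal := NormedField.toValued
  let : (Valued.v (R := F)).RankOne := inferInstanceAs (NormedField.valuation (K := F)).RankOne
  have : CompactSpace 𝒪[F] := isCompact_iff_compactSpace.1 hcompact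
  exact (compactSpace_iff_completeSpace_and_isDiscreteValuationRing_and_finite_residueField.1
    this).2

variable {p} {K : Type*} [Field K] [Algebra ℚ_[p] K] [Algebra.IsAlgebraic ℚ_[p] K]

lemma natCast_residue_ne_zero {l : ℕ} [Fact l.Prime] (hpl : p ≠ l) : (l : Residue p K) ≠ 0 := by
  have hl : (l : ℚ_[p]) ≠ 0 := Nat.cast_ne_zero.2 (Fact.out : l.Prime).ne_zero
  have hinv : (l : K)⁻¹ ∈ integers p K := by
    rw [mem_integers, ← map_natCast (algebraMap ℚ_[p] K), ← map_inv₀, spectralNorm_extends,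
      norm_inv, Padic.norm_natCast_eq_one_iff.2 ((Nat.coprime_primes Fact.out Fact.out).2 hpl),
      inv_one]
  have hmul : (l : integers p K) * ⟨(l : K)⁻¹, hinv⟩ = 1 := by
    ext
    have : (l : K) ≠ 0 := by simpa using (algebraMap ℚ_[p] K).injective.ne hl
    simp [this]
  rw [← map_natCast (IsLocalRing.residue (integers p K)), IsLocalRing.residue_ne_zero_iff_isUnit]
  exact IsUnit.of_mul_eq_one _ hmul

instance isLocalHom_integersMap {L : Type*} [Field L] [Algebra ℚ_[p] L]
    [Algebra.IsAlgebraic ℚ_[p] L] (φ : K →ₐ[ℚ_[p]] L) : IsLocalHom (integersMap p φ) where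
  map_nonunit x hx := by
    obtain ⟨y, hy⟩ := hx.exists_right_inv
    have hmul : φ x * y = 1 := congrArg Subtype.val hy
    have hx0 : (x : K) ≠ 0 := by
      rintro h
      simp [h] at hmul
    have hinv : (x : K)⁻¹ ∈ integers p K := by
      rw [mem_integers, spectralNorm, ← minpoly.algHom_eq φ φ.injective, map_inv₀,
        inv_eq_of_mul_eq_one_right hmul]
      exact y.2
    exact IsUnit.of_mul_eq_one ⟨(x : K)⁻¹, hinv⟩ (Subtype.ext (mul_inv_cancel₀ hx0))

end LocalField

section UnipotentRadical

variable {A : Type*} [Ring A]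

/-- The unipotent radical of the stabilizer of `e A`, for an idempotent `e`: the units which act
trivially on both `e A` and `A / e A`. -/
def unipotentRadical (e : A) : Subgroup Aˣ where
  carrier := {u | (u : A) * e = e ∧ e * (u - 1) = u - 1}
  one_mem' := by simp
  mul_mem' {u v} hu hv := by
    refine ⟨by rw [Units.val_mul, mul_assoc, hv.1, hu.1], ?_⟩
    have hsplit : (u * v : A) - 1 = (u - 1) * v + (v - 1) := by noncomm_ring
    rw [Units.val_mul, hsplit, mul_add, ← mul_assoc, hu.2, hv.2]
  inv_mem' {u} hu := by
    refine ⟨by rw [Units.inv_mul_eq_iff_eq_mul, hu.1], ?_⟩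
    have hsplit : (↑u⁻¹ : A) - 1 = -((u - 1) * ↑u⁻¹) := by rw [sub_mul, Units.mul_inv]; simp
    rw [hsplit, mul_neg, ← mul_assoc, hu.2]

lemma mem_unipotentRadical {e : A} {u : Aˣ} :
    u ∈ unipotentRadical e ↔ (u : A) * e = e ∧ e * (u - 1) = u - 1 := Iff.rfl

lemma conj_mem_unipotentRadical {e : A} {g u : Aˣ} (hg : (g : A) * e = e * g * e)
    (hg' : (↑g⁻¹ : A) * e = e * ↑g⁻¹ * e) (hu : u ∈ unipotentRadical e) :
    g * u * g⁻¹ ∈ unipotentRadical e := by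
  obtain ⟨hue, heu⟩ := hu
  have hconj : (g * u * g⁻¹ : A) - 1 = g * (u - 1) * ↑g⁻¹ := by simp [mul_sub, sub_mul]
  rw [mem_unipotentRadical, Units.val_mul, Units.val_mul, hconj]
  constructor
  · calc (g * u * ↑g⁻¹ : A) * e = g * (u * e) * ↑g⁻¹ * e := by
          rw [mul_assoc, hg']
          simp only [mul_assoc]
      _ = g * (↑g⁻¹ * e) := by
          rw [hue, hg']
          simp only [mul_assoc]
      _ = e := Units.mul_inv_cancel_left g e
  · calc e * (g * (u - 1) * ↑g⁻¹ : A) = e * g * e * (u - 1) * ↑g⁻¹ := by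
          rw [mul_assoc (e * g : A), heu]
          simp only [mul_assoc]
      _ = g * (u - 1) * ↑g⁻¹ := by rw [← hg, mul_assoc (g : A), heu]

lemma conj_mem_unipotentRadical_iff {e f : A} {g : Aˣ} (hg : (g : A) * e = f * g) (u : Aˣ) :
    g * u * g⁻¹ ∈ unipotentRadical f ↔ u ∈ unipotentRadical e := by
  have hf : f = g * e * ↑g⁻¹ := by rw [hg, Units.mul_inv_cancel_right]
  have hconj : (g * u * g⁻¹ : A) - 1 = g * (u - 1) * ↑g⁻¹ := by simp [mul_sub, sub_mul]
  rw [mem_unipotentRadical, mem_unipotentRadical, Units.val_mul, Units.val_mul, hconj, hf]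
  simp only [mul_assoc, Units.inv_mul_cancel_left, Units.mul_right_inj]
  simp only [← mul_assoc, Units.mul_left_inj]

lemma eq_one_of_mem_unipotentRadical_of_commute {e : A} {u : Aˣ} (hu : u ∈ unipotentRadical e)
    (hcomm : Commute e u) : u = 1 := by
  obtain ⟨hue, heu⟩ := hu
  rw [mul_sub, hcomm.eq, hue, mul_one, sub_self] at heu
  exact Units.ext (sub_eq_zero.1 heu.symm)

end UnipotentRadical

section BlockIdempotent

variable {k : Type*} [Field k] {n m : ℕ}

/-- The projection of `k ^ n` onto the span of the first `m` basis vectors. -/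
def blockIdempotent (k : Type*) [Field k] (n m : ℕ) : Matrix (Fin n) (Fin n) k :=
  Matrix.diagonal fun i => if (i : ℕ) < m then 1 else 0

lemma mem_parabolic_iff_mul_blockIdempotent {g : GL (Fin n) k} :
    g ∈ parabolic k n m ↔ (g : Matrix (Fin n) (Fin n) k) * blockIdempotent k n m =
      blockIdempotent k n m * g * blockIdempotent k n m := by
  simp only [mem_parabolic, ← Matrix.ext_iff, blockIdempotent, mul_diagonal, diagonal_mul]
  refine forall₂_congr fun i j => ?_
  by_cases hi : (i : ℕ) < m <;> by_cases hj : (j : ℕ) < m <;> simp [hi, hj, not_lt.1]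

lemma inUnipotentRadical_iff_mem_unipotentRadical {g : GL (Fin n) k} :
    InUnipotentRadical m g ↔ g ∈ unipotentRadical (blockIdempotent k n m) := by
  simp only [InUnipotentRadical, mem_unipotentRadical, ← Matrix.ext_iff, blockIdempotent,
    ← diagonal_one, mul_diagonal, diagonal_mul, ← forall_and, Matrix.sub_apply, diagonal_apply]
  refine forall₂_congr fun i j => ?_
  by_cases hi : (i : ℕ) < m <;> by_cases hj : (j : ℕ) < m <;>
    by_cases hij : i = j <;> grind

lemma blockIdempotent_mul_self :
    blockIdempotent k n m * blockIdempotent k n m = blockIdempotent k n m := by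
  simp [blockIdempotent, diagonal_mul_diagonal]

lemma blockIdempotent_zero : blockIdempotent k n 0 = 0 := by
  simp [blockIdempotent]

lemma blockIdempotent_self : blockIdempotent k n n = 1 := by
  simp [blockIdempotent]

lemma exists_basis_map_eq_ite_of_isIdempotentElem {M : Type*} [AddCommGroup M] [Module k M]
    [FiniteDimensional k M] (hn : Module.finrank k M = n) {f : Module.End k M}
    (hf : IsIdempotentElem f) :
    ∃ (b : Module.Basis (Fin n) k M) (m : ℕ), m ≤ n ∧
      ∀ j, f (b j) = if (j : ℕ) < m then b j else 0 := by
  let m := Module.finrank k (LinearMap.range f)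
  have hmn : m + Module.finrank k (LinearMap.ker f) = n := by
    rw [← hn, LinearMap.finrank_range_add_finrank_ker]
  let b := (((Module.finBasis k (LinearMap.range f)).prod
    (Module.finBasis k (LinearMap.ker f))).map (Submodule.prodEquivOfIsCompl _ _
      (LinearMap.IsIdempotentElem.isCompl hf))).reindex (finSumFinEquiv.trans (finCongr hmn))
  refine ⟨b, m, hmn ▸ Nat.le_add_right _ _, fun j => ?_⟩
  have hrange (x : LinearMap.range f) : f x = x := by
    obtain ⟨_, y, rfl⟩ := x
    rw [← Module.End.mul_apply, hf.eq]
  obtain ⟨i | i, rfl⟩ := (finSumFinEquiv.trans (finCongr hmn)).surjective j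
  · simp [b, m, hrange]
  · simp [b, m]

lemma exists_mul_eq_mul_blockIdempotent {P : Matrix (Fin n) (Fin n) k} (hP : IsIdempotentElem P) :
    ∃ (h : GL (Fin n) k) (m : ℕ), m ≤ n ∧
      P * (h : Matrix (Fin n) (Fin n) k) = h * blockIdempotent k n m := by
  obtain ⟨b, m, hmn, hb⟩ := exists_basis_map_eq_ite_of_isIdempotentElem
    (Module.finrank_fin_fun k) (hP.map toLinAlgEquiv')
  have := (Pi.basisFun k (Fin n)).invertibleToMatrix b
  refine ⟨unitOfInvertible ((Pi.basisFun k (Fin n)).toMatrix b), m, hmn, ?_⟩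
  have hdiag : LinearMap.toMatrix b b (toLinAlgEquiv' P) = blockIdempotent k n m := by
    ext i j
    rw [LinearMap.toMatrix_apply, hb, blockIdempotent, diagonal_apply]
    by_cases hj : (j : ℕ) < m <;> by_cases hij : j = i
    · simp [← hij, hj]
    · simp [hj, Ne.symm hij]
    · simp [← hij, hj]
    · simp [hj, Ne.symm hij]
  rw [← hdiag, val_unitOfInvertible, basis_toMatrix_mul_linearMap_toMatrix,
    ← linearMap_toMatrix_mul_basis_toMatrix b (Pi.basisFun k (Fin n))]
  congr 1
  exact (LinearMap.toMatrix'_toLin' P).symm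

end BlockIdempotent

section Cuspidal

lemma sum_apply_eq_zero_of_mem_coinvariants_ker {C H V : Type*} [CommRing C] [Group H] [Fintype H]
    [AddCommGroup V] [Module C V] {ρ : Representation C H V} {v : V}
    (hv : v ∈ Representation.Coinvariants.ker ρ) : ∑ h, ρ h v = 0 := by
  have hlift := Representation.Coinvariants.lift_mk ρ ρ.norm (Representation.norm_comp_self ρ) v
  rw [(Representation.Coinvariants.mk_eq_zero ρ).2 hv, map_zero] at hlift
  simpa only [Representation.norm, LinearMap.sum_apply] using hlift.symm

variable {C k : Type*} [Field C] [Field k] {n : ℕ} {V : Type u} [AddCommGroup V] [Module C V]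
  {α : Representation C (GL (Fin n) k) V}

instance normal_unipotentRadical_subgroupOf_parabolic (m : ℕ) :
    ((unipotentRadical (blockIdempotent k n m)).subgroupOf (parabolic k n m)).Normal where
  conj_mem _ hu g := conj_mem_unipotentRadical (mem_parabolic_iff_mul_blockIdempotent.1 g.2)
    (mem_parabolic_iff_mul_blockIdempotent.1 (inv_mem g.2)) hu

lemma IsCuspidal.mem_coinvariants_ker (hα : IsCuspidal α) {m : ℕ} (hm : 1 ≤ m) (hmn : m < n)
    (v : V) :
    v ∈ Representation.Coinvariants.ker ((α.comp (parabolic k n m).subtype).comp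
      ((unipotentRadical (blockIdempotent k n m)).subgroupOf (parabolic k n m)).subtype) := by
  let U := (unipotentRadical (blockIdempotent k n m)).subgroupOf (parabolic k n m)
  let β : Representation C (parabolic k n m) V := α.comp (parabolic k n m).subtype
  let jacquet := β.toCoinvariants U
  let q := Representation.Coinvariants.mk (β.comp U.subtype)
  have htrivial (g : parabolic k n m) (hg : InUnipotentRadical m (g : GL (Fin n) k)) :
      jacquet g = 1 :=
    Representation.isTrivial_def (jacquet.comp U.subtype)
      ⟨g, inUnipotentRadical_iff_mem_unipotentRadical.1 hg⟩
  let frobenius : V →ₗ[C] Representation.coindV (parabolic k n m).subtype jacquet :=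
    (LinearMap.pi fun g => q ∘ₗ α g).codRestrict _ fun v h g => by
      rw [LinearMap.pi_apply, map_mul]
      rfl
  let T : α.IntertwiningMap (Representation.coind (parabolic k n m).subtype jacquet) :=
    frobenius.intertwiningMap_of_isIntertwiningMap _ _ fun g v => Subtype.ext <| funext fun h => by
      change q (α h (α g v)) = q (α (h * g) v)
      rw [map_mul, Module.End.mul_apply]
  have hzero : T v = 0 := by rw [hα m hm hmn _ jacquet htrivial T]; rfl
  rw [← Representation.Coinvariants.mk_eq_zero]
  have := congrFun (congrArg Subtype.val hzero) 1
  change q (α 1 v) = 0 at this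
  rwa [map_one, Module.End.one_apply] at this

lemma IsCuspidal.sum_unipotentRadical_blockIdempotent_eq_zero (hα : IsCuspidal α) {m : ℕ}
    (hm : 1 ≤ m) (hmn : m < n) [Fintype (unipotentRadical (blockIdempotent k n m))] (v : V) :
    ∑ u : unipotentRadical (blockIdempotent k n m), α u v = 0 := by
  have hle : unipotentRadical (blockIdempotent k n m) ≤ parabolic k n m := fun u hu =>
    mem_parabolic_iff_mul_blockIdempotent.2 <| by
      rw [mul_assoc, hu.1, blockIdempotent_mul_self]
  let := Fintype.ofEquiv _ (Subgroup.subgroupOfEquivOfLe hle).symm.toEquiv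
  rw [← (Subgroup.subgroupOfEquivOfLe hle).sum_comp fun u => α u v]
  exact sum_apply_eq_zero_of_mem_coinvariants_ker (hα.mem_coinvariants_ker hm hmn v)

lemma IsCuspidal.sum_unipotentRadical_eq_zero (hα : IsCuspidal α)
    {P : Matrix (Fin n) (Fin n) k} (hP : IsIdempotentElem P) (hP0 : P ≠ 0) (hP1 : P ≠ 1)
    [Fintype (unipotentRadical P)] (v : V) : ∑ u : unipotentRadical P, α u v = 0 := by
  obtain ⟨h, m, hm, hPh⟩ := exists_mul_eq_mul_blockIdempotent hP
  have hm0 : 1 ≤ m := Nat.one_le_iff_ne_zero.2 fun h0 => hP0 <| by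
    rwa [h0, blockIdempotent_zero, mul_zero, Units.mul_left_eq_zero] at hPh
  have hmn : m < n := hm.lt_of_ne fun hmn => hP1 <| by
    rw [hmn, blockIdempotent_self, mul_one] at hPh
    exact h.isUnit.mul_eq_right.1 hPh
  let conj : unipotentRadical (blockIdempotent k n m) ≃ unipotentRadical P :=
    (MulAut.conj h).toEquiv.subtypeEquiv fun u =>
      (conj_mem_unipotentRadical_iff hPh.symm u).symm
  let := Fintype.ofEquiv _ conj.symm
  have hconj (u) : α (conj u) v = α h (α u (α h⁻¹ v)) := by
    simp only [← Module.End.mul_apply, ← map_mul, ← mul_assoc]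
    rfl
  rw [← conj.sum_comp fun u => α u v]
  simp only [hconj, ← map_sum]
  rw [hα.sum_unipotentRadical_blockIdempotent_eq_zero hm0 hmn, map_zero]

end Cuspidal

section FreeAction

lemma exists_sum_eq_sum_smul {H Y : Type*} [Group H] [Fintype H] [MulAction H Y] [Fintype Y]
    (hfree : ∀ y : Y, MulAction.stabilizer H y = ⊥) :
    ∃ R : Finset Y, ∀ {M : Type*} [AddCommMonoid M] (f : Y → M),
      ∑ y, f y = ∑ h : H, ∑ r ∈ R, f (h • r) := by
  classical
  let e := (MulAction.selfEquivOrbitsQuotientProd hfree).symm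
  have he (q : MulAction.orbitRel.Quotient H Y) (h : H) : e (q, h) = h • q.out := rfl
  have : Fintype (MulAction.orbitRel.Quotient H Y) := Fintype.ofFinite _
  refine ⟨Finset.univ.image (Quotient.out : MulAction.orbitRel.Quotient H Y → Y), fun f => ?_⟩
  simp only [Finset.sum_image (Quotient.out_injective.injOn), ← he]
  rw [← e.sum_comp, Fintype.sum_prod_type_right]

lemma sum_zpowers_eq_sum_range {G M : Type*} [Group G] [AddCommMonoid M] {l : ℕ} {g : G}
    [Fintype (Subgroup.zpowers g)] (hg : orderOf g = l) (hl : 0 < l) (f : G → M) :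
    ∑ h : Subgroup.zpowers g, f h = ∑ i ∈ Finset.range l, f (g ^ i) := by
  subst hg
  rw [← Fin.sum_univ_eq_sum_range, ← (finEquivZPowers (orderOf_pos_iff.1 hl)).sum_comp]
  rfl

lemma exists_sum_eq_sum_range_pow {Y : Type*} [Fintype Y] {φ : Equiv.Perm Y} {l : ℕ}
    [Fact l.Prime] (hl : φ ^ l = 1) (hfix : ∀ y, φ y ≠ y) :
    ∃ R : Finset Y, ∀ {M : Type*} [AddCommMonoid M] (f : Y → M),
      ∑ y, f y = ∑ i ∈ Finset.range l, ∑ r ∈ R, f ((φ ^ i) r) := by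
  classical
  cases isEmpty_or_nonempty Y with
  | inl _ => exact ⟨∅, by simp⟩
  | inr h =>
    obtain ⟨y₀⟩ := h
    have horder : orderOf φ = l := orderOf_eq_prime hl fun h => hfix y₀ (by simp [h])
    have := Fact.mk (p := (Nat.card (Subgroup.zpowers φ)).Prime)
      (by rw [Nat.card_zpowers, horder]; exact Fact.out)
    have hfree (y : Y) : MulAction.stabilizer (Subgroup.zpowers φ) y = ⊥ := by
      refine (Subgroup.eq_bot_or_eq_top_of_prime_card _).resolve_right fun htop => hfix y ?_
      let gen : Subgroup.zpowers φ := ⟨φ, Subgroup.mem_zpowers φ⟩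
      exact MulAction.mem_stabilizer_iff.1 (htop ▸ Subgroup.mem_top gen)
    obtain ⟨R, hR⟩ := exists_sum_eq_sum_smul hfree
    refine ⟨R, fun f => (hR f).trans ?_⟩
    exact sum_zpowers_eq_sum_range horder (Fact.out : l.Prime).pos fun ψ => ∑ r ∈ R, f (ψ r)

end FreeAction

section Conjugation

variable {G : Type*} [Group G] {U : Subgroup G} [Fintype U] {s : G} {l : ℕ} [Fact l.Prime]

lemma exists_sum_eq_add_sum_range_conj_pow (hs : s ^ l = 1) (hnorm : ∀ u, s * u * s⁻¹ ∈ U ↔ u ∈ U)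
    (hcent : ∀ u ∈ U, s * u * s⁻¹ = u → u = 1) :
    ∃ R : Finset G, ∀ {M : Type*} [AddCommMonoid M] (f : G → M),
      ∑ u : U, f u = f 1 + ∑ i ∈ Finset.range l, ∑ r ∈ R, f (s ^ i * r * (s ^ i)⁻¹) := by
  classical
  let φ : Equiv.Perm {u : U // u ≠ 1} :=
    ((MulAut.toPerm G (MulAut.conj s)).subtypePerm (p := (· ∈ U)) hnorm).subtypePerm fun u =>
      not_congr (by rw [Subtype.ext_iff, Subtype.ext_iff]; exact conj_eq_one_iff)
  have hφpow (i : ℕ) (u) : ((φ ^ i) u : G) = s ^ i * u * (s ^ i)⁻¹ := by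
    induction i with
    | zero => simp
    | succ i ih =>
      have hφ (w) : (φ w : G) = s * w * s⁻¹ := rfl
      rw [pow_succ', Equiv.Perm.mul_apply, hφ, ih]
      group
  have hφl : φ ^ l = 1 := by
    ext u
    simp [hφpow, hs]
  have hφfix (u) : φ u ≠ u := fun h => u.2 <| Subtype.ext <| hcent u u.1.2 <| by
    simpa [h] using (hφpow 1 u).symm
  obtain ⟨R, hR⟩ := exists_sum_eq_sum_range_pow hφl hφfix
  refine ⟨R.map ((Function.Embedding.subtype _).trans (Function.Embedding.subtype _)),
    fun f => ?_⟩
  rw [Fintype.sum_eq_add_sum_subtype_ne _ (1 : U), hR fun u => f u]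
  simp only [hφpow, OneMemClass.coe_one, Finset.sum_map, Function.Embedding.trans_apply,
    Function.Embedding.subtype_apply]

variable {k V : Type*} [CommRing k] [AddCommGroup V] [Module k V]

lemma exists_sum_pow_eq_of_sum_eq_zero (α : Representation k G V) (hs : s ^ l = 1)
    (hnorm : ∀ u, s * u * s⁻¹ ∈ U ↔ u ∈ U) (hcent : ∀ u ∈ U, s * u * s⁻¹ = u → u = 1)
    {L : AddSubgroup V} (hL : ∀ g, ∀ v ∈ L, α g v ∈ L) {v : V} (hv : v ∈ L) (hsv : α s v = v)
    (hU : ∑ u : U, α u v = 0) :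
    ∃ v' ∈ L, ∑ i ∈ Finset.range l, α (s ^ i) v' = v := by
  obtain ⟨R, hR⟩ := exists_sum_eq_add_sum_range_conj_pow hs hnorm hcent
  have hpow (i : ℕ) : α (s ^ i)⁻¹ v = v := by
    have hinv : α s⁻¹ v = v := by
      rw [← hsv, ← Module.End.mul_apply, ← map_mul, inv_mul_cancel, map_one, Module.End.one_apply,
        hsv]
    rw [← inv_pow, map_pow, Module.End.pow_apply]
    exact Function.iterate_fixed hinv i
  refine ⟨-∑ r ∈ R, α r v, neg_mem (sum_mem fun r _ => hL r v hv), ?_⟩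
  have hsum := hR fun u => α u v
  rw [hU, map_one, Module.End.one_apply, eq_comm, add_eq_zero_iff_eq_neg] at hsum
  conv_rhs => rw [hsum]
  simp only [map_neg, Finset.sum_neg_distrib, map_sum, map_mul, Module.End.mul_apply, hpow]

end Conjugation

section Idempotent

open Polynomial

variable {k A : Type*} [Field k] [Ring A] [Algebra k A] {s : A} {T : Finset k}

lemma aeval_eq_aeval_of_aeval_nodal_eq_zero (hs : aeval s (Lagrange.nodal T id) = 0) {f g : k[X]}
    (hfg : ∀ c ∈ T, f.eval c = g.eval c) : aeval s f = aeval s g := by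
  obtain ⟨q, hq⟩ : Lagrange.nodal T id ∣ f - g :=
    Finset.prod_dvd_of_coprime ((pairwise_coprime_X_sub_C Function.injective_id).set_pairwise _)
      fun c hc => dvd_iff_isRoot.2 (by simp [hfg c hc])
  rw [← sub_eq_zero, ← map_sub, hq, map_mul, hs, zero_mul]

/-- The spectral projections of `s` sum to `1`, so some of them is nonzero, and `s` is the scalar
`c` on the image of the projection attached to `c`. -/
lemma exists_isIdempotentElem_of_aeval_nodal_eq_zero [Nontrivial A]
    (hs : aeval s (Lagrange.nodal T id) = 0) (hns : ∀ c ∈ T, s ≠ algebraMap k A c) :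
    ∃ P ∈ Algebra.adjoin k {s}, IsIdempotentElem P ∧ P ≠ 0 ∧ P ≠ 1 := by
  classical
  let e (c : k) : k[X] := Lagrange.basis T id c
  have heval {c d : k} (hd : d ∈ T) : (e c).eval d = if c = d then 1 else 0 := by
    split_ifs with hcd
    · exact hcd ▸ Lagrange.eval_basis_self (v := id) Function.injective_id.injOn (hcd ▸ hd)
    · exact Lagrange.eval_basis_of_ne (v := id) hcd hd
  obtain ⟨c, hc, hc0⟩ : ∃ c ∈ T, aeval s (e c) ≠ 0 := by
    by_contra! hzero
    refine one_ne_zero (α := A) ?_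
    calc (1 : A) = aeval s (∑ c ∈ T, e c) := by
          rw [← map_one (aeval s : k[X] →ₐ[k] A)]
          exact aeval_eq_aeval_of_aeval_nodal_eq_zero hs fun d hd => by
            simp [eval_finsetSum, heval hd, hd]
      _ = 0 := by rw [map_sum, Finset.sum_eq_zero hzero]
  refine ⟨aeval s (e c), aeval_mem_adjoin_singleton k s, ?_, hc0, fun hc1 => hns c hc ?_⟩
  · rw [IsIdempotentElem, ← map_mul]
    exact aeval_eq_aeval_of_aeval_nodal_eq_zero hs fun d hd => by simp [heval hd]
  · have : aeval s (X * e c) = aeval s (C c * e c) :=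
      aeval_eq_aeval_of_aeval_nodal_eq_zero hs fun d hd => by
        by_cases hcd : c = d <;> simp [heval hd, hcd]
    simpa [hc1] using this

variable {l : ℕ} [Fact l.Prime]

lemma exists_isIdempotentElem_of_pow_eq_one [Nontrivial A] {ζ : k} (hζ : IsPrimitiveRoot ζ l)
    (hs : s ^ l = 1) (hns : ∀ i : ℕ, s ≠ algebraMap k A (ζ ^ i)) :
    ∃ P ∈ Algebra.adjoin k {s}, IsIdempotentElem P ∧ P ≠ 0 ∧ P ≠ 1 := by
  have hl : 0 < l := (Fact.out : l.Prime).pos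
  refine exists_isIdempotentElem_of_aeval_nodal_eq_zero (T := nthRootsFinset l (1 : k)) ?_ ?_
  · rw [Lagrange.nodal_eq]
    simp only [id]
    rw [← X_pow_sub_one_eq_prod hl hζ]
    simp [hs]
  · intro c hc
    obtain ⟨i, -, rfl⟩ := hζ.eq_pow_of_pow_eq_one ((mem_nthRootsFinset hl 1).1 hc)
    exact hns i

end Idempotent

lemma IsCuspidal.exists_sum_pow_eq {C k : Type*} [Field C] [Field k] [Finite k] {n l : ℕ}
    [Fact l.Prime] {V : Type u} [AddCommGroup V] [Module C V]
    {α : Representation C (GL (Fin n) k) V} (hα : IsCuspidal α) {ζ : k} (hζ : IsPrimitiveRoot ζ l)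
    {s : GL (Fin n) k} (hs : s ^ l = 1)
    (hns : ∀ i : ℕ, (s : Matrix (Fin n) (Fin n) k) ≠ algebraMap k _ (ζ ^ i))
    {L : AddSubgroup V} (hL : ∀ g, ∀ v ∈ L, α g v ∈ L) {v : V} (hv : v ∈ L) (hsv : α s v = v) :
    ∃ v' ∈ L, ∑ i ∈ Finset.range l, α (s ^ i) v' = v := by
  have : Nontrivial (Matrix (Fin n) (Fin n) k) := nontrivial_of_ne _ _ (hns 0)
  obtain ⟨P, hPs, hP, hP0, hP1⟩ := exists_isIdempotentElem_of_pow_eq_one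
    (s := (s : Matrix (Fin n) (Fin n) k)) hζ (by rw [← Units.val_pow_eq_pow_val, hs, Units.val_one])
    hns
  have hcomm {x} (hx : Commute (s : Matrix (Fin n) (Fin n) k) x) : Commute P x :=
    (Algebra.commute_of_mem_adjoin_singleton_of_commute hPs hx.symm).symm
  let := Fintype.ofFinite (unipotentRadical P)
  refine exists_sum_pow_eq_of_sum_eq_zero α hs
    (conj_mem_unipotentRadical_iff (hcomm (Commute.refl _)).symm.eq) (fun u hu hsu => ?_) hL hv hsv
    (hα.sum_unipotentRadical_eq_zero hP hP0 hP1 v)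
  refine eq_one_of_mem_unipotentRadical_of_commute hu (hcomm ?_)
  rw [mul_inv_eq_iff_eq_mul] at hsu
  exact congrArg Units.val hsu

section Reduction

lemma iterate_map_eq_self {m R : Type*} [Fintype m] [DecidableEq m] [CommRing R] {f : R →+* R}
    {l : ℕ} (hf : f^[l] = id) (g : GL m R) : (GeneralLinearGroup.map f)^[l] g = g := by
  have hentry (i j : m) : Function.Semiconj (fun x : GL m R => x i j)
      (GeneralLinearGroup.map f) f := fun _ => rfl
  ext i j
  exact ((hentry i j).iterate_right l g).trans (congrFun hf _)

instance isLocalHom_mapMatrix {m R S : Type*} [Fintype m] [DecidableEq m] [CommRing R] [CommRing S]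
    (f : R →+* S) [IsLocalHom f] : IsLocalHom (f.mapMatrix (m := m)) where
  map_nonunit A hA := by
    rw [isUnit_iff_isUnit_det] at hA ⊢
    exact isUnit_of_map_unit f _ (by rwa [RingHom.map_det])

variable {p : ℕ} [Fact p.Prime] {n : ℕ} {F : Type*} [Field F] [Algebra ℚ_[p] F]
  [Algebra.IsAlgebraic ℚ_[p] F]

lemma reduceGL_surjective : Function.Surjective (reduceGL p n F) := by
  let red : Matrix (Fin n) (Fin n) (integers p F) →+* Matrix (Fin n) (Fin n) (Residue p F) :=
    (IsLocalRing.residue (integers p F)).mapMatrix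
  have hred : Function.Surjective red := fun A =>
    ⟨A.map Quotient.out, Matrix.ext fun _ _ => Quotient.out_eq _⟩
  exact IsLocalRing.surjective_units_map_of_local_ringHom red hred (isLocalHom_mapMatrix _)

lemma integralGL_injective : Function.Injective (integralGL p n F) :=
  Units.map_injective (map_injective Subtype.val_injective)

end Reduction

section FixedVertices

variable {p : ℕ} [Fact p.Prime] {n : ℕ} {F : Type*} [Field F] [Algebra ℚ_[p] F]
  [Algebra.IsAlgebraic ℚ_[p] F]

lemma mem_maxCompactModCenter {g : GL (Fin n) F} :
    g ∈ maxCompactModCenter p n F ↔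
      ∃ z k, GeneralLinearGroup.scalar (Fin n) z * integralGL p n F k = g := by
  have hnormal : (GeneralLinearGroup.scalar (Fin n) : Fˣ →* GL (Fin n) F).range.Normal :=
    GeneralLinearGroup.center_eq_range_scalar (n := Fin n) (R := F) ▸ inferInstance
  simp [maxCompactModCenter, Subgroup.mem_sup_of_normal_left]

lemma vertexMk_eq_iff {g h : GL (Fin n) F} :
    vertexMk p n h = vertexMk p n g ↔
      ∃ z k, h = GeneralLinearGroup.scalar (Fin n) z * integralGL p n F k * g := by
  have hrel : vertexMk p n g = vertexMk p n h ↔ h * g⁻¹ ∈ maxCompactModCenter p n F :=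
    Quotient.eq.trans QuotientGroup.rightRel_apply
  rw [eq_comm, hrel, mem_maxCompactModCenter]
  simp only [mul_inv_eq_iff_eq_mul, eq_comm (b := h * g⁻¹)]

lemma vertexMk_integralGL_mul (k : GL (Fin n) (integers p F)) (g : GL (Fin n) F) :
    vertexMk p n (integralGL p n F k * g) = vertexMk p n g :=
  vertexMk_eq_iff.2 ⟨1, k, by rw [map_one, one_mul]⟩

lemma vertexMk_scalar_mul (z : Fˣ) (g : GL (Fin n) F) :
    vertexMk p n (GeneralLinearGroup.scalar (Fin n) z * g) = vertexMk p n g :=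
  vertexMk_eq_iff.2 ⟨z, 1, by rw [map_one, mul_one]⟩

lemma spectralNorm_coe_units (u : (integers p F)ˣ) :
    spectralNorm ℚ_[p] F (u : integers p F) = 1 := by
  refine le_antisymm (u : integers p F).2 ?_
  have hinv : (u : integers p F) * (u⁻¹ : (integers p F)ˣ) = (1 : F) :=
    congrArg Subtype.val u.mul_inv
  calc 1 = spectralNorm ℚ_[p] F (u : integers p F) *
        spectralNorm ℚ_[p] F (u⁻¹ : (integers p F)ˣ) := by
        rw [← spectralNorm_one (K := ℚ_[p]) (L := F), ← hinv]
        exact map_mul (spectralMulAlgNorm ℚ_[p] F) _ _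
    _ ≤ spectralNorm ℚ_[p] F (u : integers p F) :=
        mul_le_of_le_one_right (spectralNorm_nonneg _) ((u⁻¹ : (integers p F)ˣ) : integers p F).2

lemma exists_units_map_subtype_eq {z : Fˣ} (hz : spectralNorm ℚ_[p] F z = 1) :
    ∃ u : (integers p F)ˣ, Units.map (integers p F).subtype u = z := by
  have hinv : spectralNorm ℚ_[p] F (z : F)⁻¹ = 1 :=
    (map_inv₀ (spectralMulAlgNorm ℚ_[p] F) _).trans (inv_eq_one.2 hz)
  exact ⟨⟨⟨z, hz.le⟩, ⟨(z : F)⁻¹, hinv.le⟩, Subtype.ext (mul_inv_cancel₀ z.ne_zero),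
    Subtype.ext (inv_mul_cancel₀ z.ne_zero)⟩, Units.ext rfl⟩

variable {S : F →ₐ[ℚ_[p]] F} {g : GL (Fin n) F} {k : GL (Fin n) (integers p F)}

lemma exists_map_eq_integralGL_mul (hw : vertexMap p n S (vertexMk p n g) = vertexMk p n g) :
    ∃ k, GeneralLinearGroup.map (S : F →+* F) g = integralGL p n F k * g := by
  rcases eq_or_ne n 0 with rfl | hn
  · exact ⟨1, Units.ext (Subsingleton.elim _ _)⟩
  obtain ⟨z, k, hg⟩ := vertexMk_eq_iff.1 hw
  obtain ⟨u, rfl⟩ : ∃ u : (integers p F)ˣ, Units.map (integers p F).subtype u = z := by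
    refine exists_units_map_subtype_eq ?_
    let ν := spectralMulAlgNorm ℚ_[p] F
    have hS (x : F) : ν (S x) = ν x :=
      congrArg spectralValue (minpoly.algHom_eq S S.injective x)
    have hdet : S (g : Matrix (Fin n) (Fin n) F).det =
        z ^ n * ((GeneralLinearGroup.det k : (integers p F)ˣ) : integers p F) *
          (g : Matrix (Fin n) (Fin n) F).det := by
      have := congrArg (fun x => ((GeneralLinearGroup.det x : Fˣ) : F)) hg
      simpa [GeneralLinearGroup.map_det, integralGL] using this
    have hν := congrArg ν hdet
    have hg0 : ν (g : Matrix (Fin n) (Fin n) F).det ≠ 0 :=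
      (map_ne_zero_iff_ne_zero ν).2 (GeneralLinearGroup.det g).ne_zero
    have hk : ν ((GeneralLinearGroup.det k : (integers p F)ˣ) : integers p F) = 1 :=
      spectralNorm_coe_units _
    rw [hS, map_mul, map_mul, map_pow, hk, mul_one, right_eq_mul₀ hg0] at hν
    exact (pow_eq_one_iff_of_nonneg (apply_nonneg ν _) hn).1 hν
  refine ⟨GeneralLinearGroup.scalar (Fin n) u * k, ?_⟩
  rw [hg, map_mul, integralGL, GeneralLinearGroup.map_scalar]

namespace HasFixedResidues

variable (hS : HasFixedResidues (integersMap p S))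
  (hg : GeneralLinearGroup.map (S : F →+* F) g = integralGL p n F k * g)
include hS

lemma reduceGL_map (k : GL (Fin n) (integers p F)) :
    reduceGL p n F (GeneralLinearGroup.map (integersMap p S) k) = reduceGL p n F k := by
  ext i j
  exact hS.residue_map (k i j)

include hg

lemma exists_iterate_map_eq (i : ℕ) :
    ∃ k', (GeneralLinearGroup.map (S : F →+* F))^[i] g = integralGL p n F k' * g ∧
        reduceGL p n F k' = reduceGL p n F k ^ i := by
  induction i with
  | zero => exact ⟨1, by simp⟩
  | succ i ih =>
    obtain ⟨k', hk', hred⟩ := ih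
    refine ⟨GeneralLinearGroup.map (integersMap p S) k' * k, ?_, ?_⟩
    · rw [Function.iterate_succ_apply', hk', map_mul, hg, map_mul, mul_assoc]
      rfl
    · rw [map_mul, hS.reduceGL_map, hred, pow_succ]

lemma reduceGL_pow_eq_one {l : ℕ} (hSl : S^[l] = id) : reduceGL p n F k ^ l = 1 := by
  obtain ⟨k', hk', hred⟩ := hS.exists_iterate_map_eq hg l
  rw [iterate_map_eq_self (f := (S : F →+* F)) hSl g, right_eq_mul] at hk'
  rw [← hred, integralGL_injective (hk'.trans (map_one _).symm), map_one]

lemma exists_map_integralGL_mul_eq_self {l : ℕ} (hl : (l : Residue p F) ≠ 0) (hSl : S^[l] = id)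
    (hk : reduceGL p n F k = 1) :
    ∃ h, GeneralLinearGroup.map (S : F →+* F) (integralGL p n F h * g) =
      integralGL p n F h * g := by
  choose κ hκ hred using hS.exists_iterate_map_eq hg
  let K : Matrix (Fin n) (Fin n) (integers p F) := ∑ i ∈ Finset.range l, (κ i).val
  have hK : IsUnit K := by
    refine isUnit_of_map_unit (IsLocalRing.residue (integers p F)).mapMatrix _ ?_
    have hκ1 (i : ℕ) : (IsLocalRing.residue (integers p F)).mapMatrix (κ i).val = 1 := by
      simp only [hk, one_pow] at hred
      exact congrArg Units.val (hred i)
    rw [map_sum, Finset.sum_congr rfl fun i _ => hκ1 i, Finset.sum_const, Finset.card_range,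
      nsmul_one, ← map_natCast (algebraMap (Residue p F) (Matrix (Fin n) (Fin n) (Residue p F)))]
    exact (isUnit_iff_ne_zero.2 hl).map _
  let φ : Matrix (Fin n) (Fin n) F →+ Matrix (Fin n) (Fin n) F :=
    AddMonoidHom.mapMatrix (S : F →+ F)
  have hsemi : Function.Semiconj Units.val (GeneralLinearGroup.map (S : F →+* F)) φ := fun _ => rfl
  have htrace : ((integralGL p n F hK.unit * g : GL (Fin n) F) : Matrix (Fin n) (Fin n) F) =
      ∑ i ∈ Finset.range l, φ^[i] g := by
    have hsum : ((integralGL p n F hK.unit : GL (Fin n) F) : Matrix (Fin n) (Fin n) F) =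
        ∑ i ∈ Finset.range l, ((integralGL p n F (κ i) : GL (Fin n) F) : Matrix _ _ F) :=
      map_sum (integers p F).subtype.mapMatrix _ _
    rw [Units.val_mul, hsum, Finset.sum_mul]
    refine Finset.sum_congr rfl fun i _ => ?_
    rw [← Units.val_mul, ← hκ, (hsemi.iterate_right i).eq]
  refine ⟨hK.unit, Units.ext ?_⟩
  rw [hsemi.eq, htrace]
  refine map_sum_iterate_eq_self ?_
  rw [← (hsemi.iterate_right l).eq, iterate_map_eq_self (f := (S : F →+* F)) hSl g]

end HasFixedResidues

variable {E : Type*} [Field E] [Algebra ℚ_[p] E] [Algebra E F] [IsScalarTower ℚ_[p] E F]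
  [Algebra.IsAlgebraic ℚ_[p] E]

lemma vertexMk_mem_range_vertexEmbedding
    (hg : ∀ i j, g i j ∈ Set.range (algebraMap E F)) :
    vertexMk p n g ∈ Set.range (vertexEmbedding p n E F) := by
  choose a ha using hg
  have hmap : (algebraMap E F).mapMatrix (of a) = g := Matrix.ext ha
  have hdet : (of a).det ≠ 0 := fun h0 => (GeneralLinearGroup.det g).ne_zero <| by
    rw [GeneralLinearGroup.val_det_apply, ← hmap, ← RingHom.map_det, h0, map_zero]
  exact ⟨vertexMk p n (GeneralLinearGroup.mkOfDetNeZero (of a) hdet),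
    congrArg (vertexMk p n) (Units.ext hmap)⟩

namespace HasFixedResidues

variable (hS : HasFixedResidues (integersMap p S))
  (hg : GeneralLinearGroup.map (S : F →+* F) g = integralGL p n F k * g)
include hS hg

lemma vertexMk_mem_range_vertexEmbedding {l : ℕ} (hl : (l : Residue p F) ≠ 0) (hSl : S^[l] = id)
    (hfix : ∀ x, S x = x → x ∈ Set.range (algebraMap E F)) {ϖ : F} {u : (integers p F)ˣ}
    (hϖ : ϖ ≠ 0) (hu : S ϖ = (u : integers p F) * ϖ) (i : ℕ)
    (hk : reduceGL p n F k =
      GeneralLinearGroup.scalar (Fin n) (Units.map (IsLocalRing.residue (integers p F)) u ^ i)) :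
    vertexMk p n g ∈ Set.range (vertexEmbedding p n E F) := by
  let z : Fˣ := (Units.mk0 ϖ hϖ)⁻¹ ^ i
  have hz : Units.map ((S : F →+* F) : F →* F) z =
      Units.map (integers p F).subtype (u⁻¹ ^ i) * z := by
    have : Units.map ((S : F →+* F) : F →* F) (Units.mk0 ϖ hϖ) =
        Units.map (integers p F).subtype u * Units.mk0 ϖ hϖ := Units.ext hu
    simp only [z, map_pow, map_inv, this, mul_inv, mul_pow]
  have hzg : GeneralLinearGroup.map (S : F →+* F) (GeneralLinearGroup.scalar (Fin n) z * g) =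
      integralGL p n F (GeneralLinearGroup.scalar (Fin n) (u⁻¹ ^ i) * k) *
        (GeneralLinearGroup.scalar (Fin n) z * g) := by
    rw [map_mul, hg, GeneralLinearGroup.map_scalar, hz, map_mul, map_mul, integralGL,
      GeneralLinearGroup.map_scalar]
    simp only [mul_assoc]
    rw [← mul_assoc (GeneralLinearGroup.scalar _ z), GeneralLinearGroup.scalar_commute z, mul_assoc]
  have hred : reduceGL p n F (GeneralLinearGroup.scalar (Fin n) (u⁻¹ ^ i) * k) = 1 := by
    rw [map_mul, hk, reduceGL, GeneralLinearGroup.map_scalar, ← map_mul]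
    simp
  obtain ⟨h, hh⟩ := hS.exists_map_integralGL_mul_eq_self hzg hl hSl hred
  rw [← vertexMk_scalar_mul z, ← vertexMk_integralGL_mul h]
  exact TateBuilding.vertexMk_mem_range_vertexEmbedding fun i j =>
    hfix _ (congrArg (fun x : GL (Fin n) F => x i j) hh)

end HasFixedResidues

end FixedVertices

section Sections

variable {p l : ℕ} [Fact p.Prime] [Fact l.Prime] {n : ℕ} {F : Type*} [Field F] [Algebra ℚ_[p] F]
  [Algebra.IsAlgebraic ℚ_[p] F] {V : Type*} [AddCommGroup V] [Module (PadicAlgCl l) V]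
  {α : Representation (PadicAlgCl l) (GL (Fin n) (Residue p F)) V}
  {ω : Fˣ →* (integers l (PadicAlgCl l))ˣ} {L : Submodule (integers l (PadicAlgCl l)) V}

lemma vertexMap_injective {S : F →ₐ[ℚ_[p]] F} (hSl : S^[l] = id) :
    Function.Injective (vertexMap p n S) := by
  have hsemi : Function.Semiconj (vertexMk p n) (GeneralLinearGroup.map (S : F →+* F))
      (vertexMap p n S) := fun _ => rfl
  have hiter : (vertexMap p n S)^[l] = id := by
    ext ⟨g⟩
    refine (hsemi.iterate_right l g).symm.trans ?_
    rw [iterate_map_eq_self (f := (S : F →+* F)) hSl g]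
    rfl
  rw [← Nat.succ_pred (Fact.out : l.Prime).ne_zero, Function.iterate_succ] at hiter
  exact (hiter ▸ Function.injective_id).of_comp

section CompactInduction

variable {f : GL (Fin n) F → V} (hf : f ∈ compactInduction α ω)
include hf

lemma apply_integralGL_mul (k : GL (Fin n) (integers p F)) (g : GL (Fin n) F) :
    f (integralGL p n F k * g) = α (reduceGL p n F k) (f g) := by
  simpa using hf.1 1 k g

lemma apply_scalar_mul (z : Fˣ) (g : GL (Fin n) F) :
    f (GeneralLinearGroup.scalar (Fin n) z * g) =
      ((ω z : integers l (PadicAlgCl l)) : PadicAlgCl l) • f g := by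
  simpa using hf.1 z 1 g

lemma map_units_eq_of_twist_eq_self {S : F →+* F} (hfS : twist l n V S f = f) (hf0 : f ≠ 0)
    (z : Fˣ) : ω (Units.map (S : F →* F) z) = ω z := by
  obtain ⟨g, hg⟩ := Function.ne_iff.1 hf0
  have hinv (h : GL (Fin n) F) : f (GeneralLinearGroup.map S h) = f h := congrFun hfS h
  refine Units.ext (Subtype.ext (smul_left_injective _ hg ?_))
  calc ((ω (Units.map (S : F →* F) z) : integers l (PadicAlgCl l)) : PadicAlgCl l) • f g
      = f (GeneralLinearGroup.map S (GeneralLinearGroup.scalar (Fin n) z * g)) := by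
        rw [map_mul, GeneralLinearGroup.map_scalar, apply_scalar_mul hf, hinv]
    _ = ((ω z : integers l (PadicAlgCl l)) : PadicAlgCl l) • f g := by
        rw [hinv, apply_scalar_mul hf]

end CompactInduction

lemma twist_mem_compactSections {S : F →ₐ[ℚ_[p]] F}
    (hS : HasFixedResidues (integersMap p S)) (hSl : S^[l] = id)
    (hωS : ∀ z, ω (Units.map ((S : F →+* F) : F →* F) z) = ω z) {U : Set (Vertex p n F)}
    {f : GL (Fin n) F → V} (hf : f ∈ compactSections α ω L U) :
    twist l n V (S : F →+* F) f ∈ compactSections α ω L (vertexMap p n S ⁻¹' U) := by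
  obtain ⟨⟨hequiv, T, hT, hfT⟩, hfL, hfU⟩ := hf
  refine ⟨⟨fun z k h => ?_, _, hT.preimage (vertexMap_injective hSl).injOn,
    fun _ hh => hfT _ hh⟩, fun _ => hfL _, fun _ hh => hfU _ hh⟩
  calc f (GeneralLinearGroup.map (S : F →+* F)
        (GeneralLinearGroup.scalar (Fin n) z * integralGL p n F k * h))
      = f (GeneralLinearGroup.scalar (Fin n) (Units.map ((S : F →+* F) : F →* F) z) *
          integralGL p n F (GeneralLinearGroup.map (integersMap p S) k) *
          GeneralLinearGroup.map (S : F →+* F) h) := by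
        rw [map_mul, map_mul, GeneralLinearGroup.map_scalar]
        rfl
    _ = ((ω z : integers l (PadicAlgCl l)) : PadicAlgCl l) •
          α (reduceGL p n F k) (f (GeneralLinearGroup.map (S : F →+* F) h)) := by
        rw [hequiv, hωS, hS.reduceGL_map]

variable {g : GL (Fin n) F}

lemma eq_of_apply_eq_of_mem_compactSections {f f' : GL (Fin n) F → V}
    (hf : f ∈ compactSections α ω L {vertexMk p n g})
    (hf' : f' ∈ compactSections α ω L {vertexMk p n g}) (hg : f g = f' g) : f = f' := by
  ext h
  by_cases hh : vertexMk p n h = vertexMk p n g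
  · obtain ⟨z, k, rfl⟩ := vertexMk_eq_iff.1 hh
    rw [hf.1.1, hf'.1.1, hg]
  · rw [hf.2.2 h hh, hf'.2.2 h hh]

/-- The lattice of values at `g` of the sections supported at the vertex of `g`. Evaluation at `g`
identifies it with the stalk at this vertex. -/
def stalkValues (α : Representation (PadicAlgCl l) (GL (Fin n) (Residue p F)) V)
    (ω : Fˣ →* (integers l (PadicAlgCl l))ˣ) (L : Submodule (integers l (PadicAlgCl l)) V)
    (g : GL (Fin n) F) : Submodule (integers l (PadicAlgCl l)) V :=
  (compactSections α ω L {vertexMk p n g}).map (LinearMap.proj g)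

lemma apply_mem_stalkValues (x : GL (Fin n) (Residue p F)) {v : V} (hv : v ∈ stalkValues α ω L g) :
    α x v ∈ stalkValues α ω L g := by
  obtain ⟨f, hf, rfl⟩ := hv
  obtain ⟨k, rfl⟩ := reduceGL_surjective x
  let y := g⁻¹ * integralGL p n F k * g
  have hgy : g * y = integralGL p n F k * g := by simp only [y, mul_assoc, mul_inv_cancel_left]
  have hgy' : g * y⁻¹ = integralGL p n F k⁻¹ * g := by simp only [y, map_inv]; group
  refine ⟨fun h => f (h * y), ⟨(levelZeroRep α ω y ⟨f, hf.1⟩).2, fun _ => hf.2.1 _, fun h hh =>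
    hf.2.2 _ fun hhy => hh ?_⟩, ?_⟩
  · calc vertexMk p n h = vertexTranslate y⁻¹ (vertexMk p n (h * y)) :=
          congrArg (vertexMk p n) (mul_inv_cancel_right h y).symm
      _ = vertexMk p n (g * y⁻¹) := congrArg (vertexTranslate y⁻¹) hhy
      _ = vertexMk p n g := by rw [hgy', vertexMk_integralGL_mul]
  · calc f (g * y) = f (integralGL p n F k * g) := by rw [hgy]
      _ = α (reduceGL p n F k) (f g) := apply_integralGL_mul hf.1 k g

end Sections

section Stalks

variable {p l : ℕ} [Fact p.Prime] [Fact l.Prime] {n : ℕ} {F : Type*} [Field F] [Algebra ℚ_[p] F]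
  [Algebra.IsAlgebraic ℚ_[p] F] {V : Type u} [AddCommGroup V] [Module (PadicAlgCl l) V]
  {α : Representation (PadicAlgCl l) (GL (Fin n) (Residue p F)) V}
  {ω : Fˣ →* (integers l (PadicAlgCl l))ˣ} {L : Submodule (integers l (PadicAlgCl l)) V}
  {S : F →ₐ[ℚ_[p]] F} {g : GL (Fin n) F} {k : GL (Fin n) (integers p F)}

lemma twist_pow_mem_compactSections_and_apply
    (hS : HasFixedResidues (integersMap p S)) (hSl : S^[l] = id)
    (hωS : ∀ z, ω (Units.map ((S : F →+* F) : F →* F) z) = ω z)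
    (hg : GeneralLinearGroup.map (S : F →+* F) g = integralGL p n F k * g)
    {f : GL (Fin n) F → V} (hf : f ∈ compactSections α ω L {vertexMk p n g}) (i : ℕ) :
    (twist l n V (S : F →+* F) ^ i) f ∈ compactSections α ω L {vertexMk p n g} ∧
      (twist l n V (S : F →+* F) ^ i) f g = α (reduceGL p n F k ^ i) (f g) := by
  have hfixed : vertexMap p n S (vertexMk p n g) = vertexMk p n g :=
    (congrArg (vertexMk p n) hg).trans (vertexMk_integralGL_mul k g)
  have hpre : vertexMap p n S ⁻¹' {vertexMk p n g} = {vertexMk p n g} := by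
    ext w
    exact (vertexMap_injective hSl).eq_iff' hfixed
  induction i with
  | zero => exact ⟨hf, by simp⟩
  | succ i ih =>
    obtain ⟨hmem, happly⟩ := ih
    rw [pow_succ', Module.End.mul_apply]
    refine ⟨hpre ▸ twist_mem_compactSections hS hSl hωS hmem, ?_⟩
    calc twist l n V (S : F →+* F) ((twist l n V (S : F →+* F) ^ i) f) g
        = (twist l n V (S : F →+* F) ^ i) f (integralGL p n F k * g) := by
          rw [← hg]
          rfl
      _ = α (reduceGL p n F k ^ (i + 1)) (f g) := by
          rw [apply_integralGL_mul hmem.1, happly, pow_succ', map_mul, Module.End.mul_apply]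

lemma IsCuspidal.subsingleton_tateZero [Finite (Residue p F)] (hα : IsCuspidal α)
    (hS : HasFixedResidues (integersMap p S)) (hSl : S^[l] = id)
    (hg : GeneralLinearGroup.map (S : F →+* F) g = integralGL p n F k * g)
    {ζ : Residue p F} (hζ : IsPrimitiveRoot ζ l)
    (hk : ∀ i : ℕ, (reduceGL p n F k : Matrix (Fin n) (Fin n) (Residue p F)) ≠
      algebraMap (Residue p F) _ (ζ ^ i)) :
    Subsingleton (TateZero α ω L (S : F →+* F) {vertexMk p n g}) := by
  rw [Submodule.Quotient.subsingleton_iff, Submodule.submoduleOf_eq_top]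
  rintro f ⟨hf, hinv⟩
  have hfS : twist l n V (S : F →+* F) f = f := (sub_eq_zero.1 hinv).symm
  rcases eq_or_ne f 0 with rfl | hf0
  · exact zero_mem _
  have hωS := map_units_eq_of_twist_eq_self hf.1 hfS hf0
  have hfg : α (reduceGL p n F k) (f g) = f g := by
    rw [← apply_integralGL_mul hf.1, ← hg]
    exact congrFun hfS g
  obtain ⟨_, ⟨f', hf', rfl⟩, hsum⟩ := hα.exists_sum_pow_eq hζ (hS.reduceGL_pow_eq_one hg hSl) hk
    (L := (stalkValues α ω L g).toAddSubgroup) (fun x _ => apply_mem_stalkValues x)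
    ⟨f, hf, rfl⟩ hfg
  have htwist := twist_pow_mem_compactSections_and_apply hS hSl hωS hg hf'
  refine ⟨f', hf', eq_of_apply_eq_of_mem_compactSections (g := g) ?_ hf ?_⟩
  · rw [LinearMap.sum_apply]
    exact sum_mem fun i _ => (htwist i).1
  · rw [LinearMap.sum_apply, Finset.sum_apply]
    exact (Finset.sum_congr rfl fun i _ => (htwist i).2).trans hsum

end Stalks

section Automorphism

variable {p : ℕ} [Fact p.Prime]

lemma integersMap_ne_id {F : Type*} [Field F] [Algebra ℚ_[p] F] [Algebra.IsAlgebraic ℚ_[p] F]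
    {S : F →ₐ[ℚ_[p]] F} (hS : S ≠ AlgHom.id ℚ_[p] F) : integersMap p S ≠ RingHom.id _ := by
  contrapose! hS
  have hfix {x : F} (hx : x ∈ integers p F) : S x = x :=
    congrArg Subtype.val (RingHom.congr_fun hS ⟨x, hx⟩)
  ext x
  rcases (integers p F).mem_or_inv_mem x with hx | hx
  · exact hfix hx
  · exact inv_injective ((map_inv₀ S x).symm.trans (hfix hx))

lemma iterate_integersMap_eq_id {F : Type*} [Field F] [Algebra ℚ_[p] F]
    [Algebra.IsAlgebraic ℚ_[p] F] {S : F →ₐ[ℚ_[p]] F} {l : ℕ} (hSl : S^[l] = id) :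
    (integersMap p S)^[l] = id := by
  have hval : Function.Semiconj Subtype.val (integersMap p S) S := fun _ => rfl
  ext x
  exact ((hval.iterate_right l) x).trans (congrFun hSl x)

variable {E F : Type*} [Field E] [Field F] [Algebra E F]

lemma IsTotallyRamified.hasFixedResidues [Algebra ℚ_[p] E] [Algebra ℚ_[p] F]
    [IsScalarTower ℚ_[p] E F] [Algebra.IsAlgebraic ℚ_[p] E] [Algebra.IsAlgebraic ℚ_[p] F]
    (hram : IsTotallyRamified p E F) (σ : F →ₐ[E] F) :
    HasFixedResidues (integersMap p (σ.restrictScalars ℚ_[p])) := fun x =>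
  let ⟨a, ha⟩ := hram (IsLocalRing.residue (integers p F) x)
  ⟨integersMap p (IsScalarTower.toAlgHom ℚ_[p] E F) a, Subtype.ext (σ.commutes a), ha⟩

lemma orderOf_eq_finrank_of_forall_mem_zpowers [FiniteDimensional E F] [IsGalois E F]
    {σ : F ≃ₐ[E] F} (hσ : ∀ τ, τ ∈ Subgroup.zpowers σ) : orderOf σ = Module.finrank E F :=
  (orderOf_eq_card_of_forall_mem_zpowers hσ).trans (IsGalois.card_aut_eq_finrank E F)

lemma iterate_orderOf_eq_id (σ : F ≃ₐ[E] F) : σ^[orderOf σ] = id := by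
  rw [← AlgEquiv.coe_pow, pow_orderOf_eq_one]
  rfl

lemma mem_range_algebraMap_of_forall_mem_zpowers [FiniteDimensional E F] [IsGalois E F]
    {σ : F ≃ₐ[E] F} (hσ : ∀ τ, τ ∈ Subgroup.zpowers σ) {x : F} (hx : σ x = x) :
    x ∈ Set.range (algebraMap E F) :=
  (IsGalois.mem_range_algebraMap_iff_fixed x).2 fun τ =>
    (Subgroup.zpowers_le.2 (MulAction.mem_stabilizer_iff.2 hx) :
      Subgroup.zpowers σ ≤ MulAction.stabilizer (F ≃ₐ[E] F) x) (hσ τ)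

end Automorphism

end TateBuilding

end

open TateBuilding in
theorem mainTheorem11_general {p l : ℕ} [Fact p.Prime] [Fact l.Prime] (hpl : p ≠ l) (n : ℕ)
    {E F : Type*} [Field E] [Field F] [Algebra ℚ_[p] E] [Algebra ℚ_[p] F] [Algebra E F]
    [IsScalarTower ℚ_[p] E F] [Algebra.IsAlgebraic ℚ_[p] E] [FiniteDimensional ℚ_[p] F]
    [IsGalois E F] (hdeg : Module.finrank E F = l) (hram : IsTotallyRamified p E F)
    (σ : F ≃ₐ[E] F) (hσ : ∀ τ : F ≃ₐ[E] F, τ ∈ Subgroup.zpowers σ)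
    {V : Type u} [AddCommGroup V] [Module (PadicAlgCl l) V]
    (α : Representation (PadicAlgCl l) (GL (Fin n) (Residue p F)) V) (hcusp : IsCuspidal α)
    (ω : Fˣ →* (integers l (PadicAlgCl l))ˣ) (L : Submodule (integers l (PadicAlgCl l)) V) :
    tateSupport α ω L ((σ : F →ₐ[E] F).restrictScalars ℚ_[p]) ⊆
      Set.range (vertexEmbedding p n E F) := by
  rintro w ⟨hw, hnontrivial⟩
  obtain ⟨g, rfl⟩ : ∃ g, vertexMk p n g = w := Quotient.exists_rep w
  have : FiniteDimensional E F := Module.Finite.of_restrictScalars_finite ℚ_[p] E F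
  obtain ⟨_, _⟩ := isDiscreteValuationRing_and_finite_residue p F
  set S := (σ : F →ₐ[E] F).restrictScalars ℚ_[p]
  have horder : orderOf σ = l := (orderOf_eq_finrank_of_forall_mem_zpowers hσ).trans hdeg
  have hSl : S^[l] = id := horder ▸ iterate_orderOf_eq_id σ
  have hS1 : S ≠ AlgHom.id ℚ_[p] F := fun h => (Fact.out : l.Prime).ne_one <|
    horder ▸ orderOf_eq_one_iff.2 (AlgEquiv.ext fun x => DFunLike.congr_fun h x)
  have hS : HasFixedResidues (integersMap p S) := hram.hasFixedResidues (σ : F →ₐ[E] F)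
  have hl : (l : Residue p F) ≠ 0 := natCast_residue_ne_zero hpl
  obtain ⟨ϖ, u, hϖ, hu, hζ⟩ :=
    hS.exists_map_eq_unit_mul hl (iterate_integersMap_eq_id hSl) (integersMap_ne_id hS1)
  obtain ⟨k, hg⟩ := exists_map_eq_integralGL_mul hw
  by_cases hk : ∃ i : ℕ, reduceGL p n F k = GeneralLinearGroup.scalar (Fin n)
      (Units.map (IsLocalRing.residue (integers p F)) u ^ i)
  · obtain ⟨i, hk⟩ := hk
    exact hS.vertexMk_mem_range_vertexEmbedding hg hl hSl
      (fun _ => mem_range_algebraMap_of_forall_mem_zpowers hσ)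
      (Subtype.coe_ne_coe.2 hϖ) (congrArg Subtype.val hu) i hk
  · exact absurd hnontrivial (not_nontrivial_iff_subsingleton.2
      (hcusp.subsingleton_tateZero hS hSl hg hζ fun i hi => hk ⟨i, Units.ext hi⟩))

open TateBuilding in
theorem mainTheorem11 {p l : ℕ} [Fact p.Prime] [Fact l.Prime] (hpl : p ≠ l) (n : ℕ)
    {E F : Type*} [Field E] [Field F] [Algebra ℚ_[p] E] [Algebra ℚ_[p] F] [Algebra E F]
    [IsScalarTower ℚ_[p] E F] [FiniteDimensional ℚ_[p] E] [FiniteDimensional ℚ_[p] F]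
    [IsGalois E F] (hdeg : Module.finrank E F = l) (hram : IsTotallyRamified p E F)
    (σ : F ≃ₐ[E] F) (hσ : ∀ τ : F ≃ₐ[E] F, τ ∈ Subgroup.zpowers σ)
    {V : Type u} [AddCommGroup V] [Module (PadicAlgCl l) V] [FiniteDimensional (PadicAlgCl l) V]
    (α : Representation (PadicAlgCl l) (GL (Fin n) (Residue p F)) V)
    (hirr : α.IsIrreducible) (hcusp : IsCuspidal α)
    (ω : Fˣ →* (integers l (PadicAlgCl l))ˣ) (hω : ExtendsCentralCharacter α ω)
    (hgal : IsGaloisEquivariant E (levelZeroRep α ω))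
    (L : Submodule (integers l (PadicAlgCl l)) V) (hL : IsStableLattice α L) :
    tateSupport α ω L ((σ : F →ₐ[E] F).restrictScalars ℚ_[p]) ⊆
      Set.range (vertexEmbedding p n E F) :=
  mainTheorem11_general hpl n hdeg hram σ hσ α hcusp ω L
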